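/- Setting. Fix $\lambda,\mu>0$ (Implementation Model $(\lambda,\mu)$: $\lambda$ is the minimum distance between nodes and $\mu$ the coefficient of information-friction, which converts bit-meters into energy and does not enter the bound). A circuit is a square $[0,l]^2$, $l>0$, with a finite set of computational nodes at points of $\lambda\mathbb{Z}^2\cap[0,l]^2$. An encoder computation on the circuit stores $k$ independent fair input bits $b=(b_1,\dots,b_k)$ at $k$ distinct input nodes and produces $n$ codeword bits $X=(X_1,\dots,X_n)$ at $n$ distinct output nodes. Finitely many messages, which are binary strings, are sent in a predetermined order, each from a predetermined node to a predetermined different node. Each message is a function of the input bit (if any) stored at the transmitting node and of the messages received there so far; each codeword bit is a function of the input bit (if any) stored at its output node and of all messages received there. The computation is *fixed-message-length* if the message lengths do not depend on the input $b$. It is *flexible-message-length* if they may depend on $b$, every message having at least one bit. The bit-meters of a link (an ordered pair of nodes) on input $b$ are the total number of bits carried by the messages on it times the Euclidean distance between its two nodes; the bit-meters of the circuit are the sum over all links; and $\overline{\mathrm{bit\text{-}meters}}(\mathrm{EncCkt})$ is their average over the uniformly distributed $b\in\{0,1\}^k$. The codeword $X$ is sent over Channel Model $(\zeta,\sigma_z^2)$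 with transmit power $P_T$ (where $\zeta,\sigma_z^2,P_T>0$), that is, over $n$ independent uses of a binary symmetric channel with crossover probability $p_{ch}=\mathbb{Q}\big(\sqrt{\zeta P_T/\sigma_z^2}\big)$, $\mathbb{Q}(x)=\int_x^\infty \frac{1}{\sqrt{2\pi}}e^{-t^2/2}\,dt$. An arbitrary decoder maps the channel output $Y\in\{0,1\}^n$ to an estimate $\widehat b$, and $P_e^{\mathrm{blk}}=\Pr(\widehat b\ne b)$. Theorem 2. For every such encoder circuit and computation, whether fixed- or flexible-message-length, and every decoder, if $$\log\frac{1}{10P_e^{\mathrm{blk}}}>50\log\frac{1}{2p_{ch}},$$ then $$\overline{\mathrm{bit\text{-}meters}}(\mathrm{EncCkt})\ \ge\ \frac{k}{48\sqrt2}\sqrt{\frac{\log\frac{1}{10P_e^{\mathrm{blk}}}}{\log\frac{1}{2p_{ch}}}}\;\lambda .$$ -/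

import Mathlib

open scoped BigOperators

noncomputable section

namespace InfoFriction

/-! ## Channel -/

/-- The Gaussian tail function `Q(x) = ∫_x^∞ (1/√(2π)) exp(-t²/2) dt`. -/
def gaussianQ (x : ℝ) : ℝ :=
  ∫ t in Set.Ioi x, 1 / Real.sqrt (2 * Real.pi) * Real.exp (-t ^ 2 / 2)

/-- Channel Model `(ζ, σ_z²)`: path loss `ζ` and noise variance `σ_z²`. -/
structure ChannelModel where
  zeta : ℝ
  sigmaSq : ℝ
  zeta_pos : 0 < zeta
  sigmaSq_pos : 0 < sigmaSq

/-- Crossover probability of the binary symmetric channel that hard decisions make of BPSK over the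
AWGN channel with transmit power `PT`. -/
def ChannelModel.pch (Ch : ChannelModel) (PT : ℝ) : ℝ :=
  gaussianQ (Real.sqrt (Ch.zeta * PT / Ch.sigmaSq))

/-- `n` independent uses of the binary symmetric channel with crossover probability `p`: the
probability of receiving `y` when `x` is sent. -/
def bscProb (p : ℝ) {n : ℕ} (x y : Fin n → Bool) : ℝ :=
  ∏ j, if y j = x j then 1 - p else p

open Classical in
/-- Average block-error probability `Pr(b̂ ≠ b)` for `k` fair message bits `b`, the codeword
`enc b`, the BSC with crossover probability `p`, and the decoder `dec`. -/
def blockErrorProb {k n : ℕ} (p : ℝ) (enc : (Fin k → Bool) → (Fin n → Bool))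
    (dec : (Fin n → Bool) → (Fin k → Bool)) : ℝ :=
  (∑ b : Fin k → Bool, ∑ y : Fin n → Bool, if dec y ≠ b then bscProb p (enc b) y else 0) / 2 ^ k

/-! ## Circuits -/

/-- Implementation Model `(λ, μ)`: minimum node distance `λ` and coefficient of
information-friction `μ`, which turns bit-meters into energy. -/
structure ImplementationModel where
  lam : ℝ
  mu : ℝ
  lam_pos : 0 < lam
  mu_pos : 0 < mu

/-- The substrate `Sq(l)`, a square of side `l` in the Euclidean plane. -/
def substrate (l : ℝ) : Set (EuclideanSpace ℝ (Fin 2)) :=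
  {x | ∀ i, 0 ≤ x i ∧ x i ≤ l}

/-- The square lattice of spacing `lam`. -/
def squareLattice (lam : ℝ) : Set (EuclideanSpace ℝ (Fin 2)) :=
  {x | ∃ s t : ℤ, x = !₂[(s : ℝ) * lam, (t : ℝ) * lam]}

/-- The lattice points that lie in the substrate. -/
def grid (lam l : ℝ) : Set (EuclideanSpace ℝ (Fin 2)) :=
  squareLattice lam ∩ substrate l

/-- A circuit: a substrate with a set of computational nodes on the grid. -/
structure Circuit (M : ImplementationModel) where
  side : ℝ
  side_pos : 0 < side
  nodes : Finset (EuclideanSpace ℝ (Fin 2))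
  nodes_subset : (nodes : Set (EuclideanSpace ℝ (Fin 2))) ⊆ grid M.lam side

/-- The type of computational nodes of a circuit. -/
abbrev Circuit.Node {M : ImplementationModel} (C : Circuit M) : Type :=
  {x : EuclideanSpace ℝ (Fin 2) // x ∈ C.nodes}

/-! ## Computations -/

/-- A computation with `k` input bits and `n` output bits on the circuit `C`. The messages are
numbered in their predetermined order; the content of a message (a bit string, whose length may
vary) is given for every input of the computation. That something is a function of what a node
knows is expressed as: it agrees on any two inputs on which the node's knowledge agrees. -/
structure Computation {M : ImplementationModel} (C : Circuit M) (k n : ℕ) where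
  /-- each input node stores one input bit -/
  inputNode : Fin k ↪ C.Node
  /-- each output node stores one output bit -/
  outputNode : Fin n ↪ C.Node
  /-- number of messages sent -/
  numMessages : ℕ
  /-- transmitting node of a message -/
  src : Fin numMessages → C.Node
  /-- receiving node of a message -/
  dst : Fin numMessages → C.Node
  src_ne_dst : ∀ t, src t ≠ dst t
  /-- content of a message, for a given input -/
  message : (Fin k → Bool) → Fin numMessages → List Bool
  /-- output bits, for a given input -/
  output : (Fin k → Bool) → Fin n → Bool
  /-- a message is a function of the input bit (if any) stored at its transmitting node and of the
  messages received there before -/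
  message_causal : ∀ (t : Fin numMessages) (b b' : Fin k → Bool),
    (∀ i, inputNode i = src t → b i = b' i) →
    (∀ s, s < t → dst s = src t → message b s = message b' s) →
    message b t = message b' t
  /-- an output bit is a function of the input bit (if any) stored at its output node and of all
  messages received there -/
  output_causal : ∀ (j : Fin n) (b b' : Fin k → Bool),
    (∀ i, inputNode i = outputNode j → b i = b' i) →
    (∀ s, dst s = outputNode j → message b s = message b' s) →
    output b j = output b' j

namespace Computation

variable {M : ImplementationModel} {C : Circuit M} {k n : ℕ}

/-- Fixed message lengths: no message length depends on the input. -/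
def IsFixedLength (E : Computation C k n) : Prop :=
  ∀ t b b', (E.message b t).length = (E.message b' t).length

/-- Flexible message lengths: lengths may depend on the input, and are at least one bit. -/
def IsFlexibleLength (E : Computation C k n) : Prop :=
  ∀ t b, 1 ≤ (E.message b t).length

open Classical in
/-- Total number of bits carried by the messages on the link from `u` to `v`. -/
def linkBits (E : Computation C k n) (b : Fin k → Bool) (u v : C.Node) : ℕ :=
  ∑ t with E.src t = u ∧ E.dst t = v, (E.message b t).length

/-- Bit-meters of a link: number of bits times the Euclidean length of the link. -/
def linkBitMeters (E : Computation C k n) (b : Fin k → Bool) (u v : C.Node) : ℝ :=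
  (E.linkBits b u v : ℝ) * dist (u : EuclideanSpace ℝ (Fin 2)) (v : EuclideanSpace ℝ (Fin 2))

/-- Bit-meters of the whole circuit on input `b`: the sum over all (directed) links. -/
def bitMeters (E : Computation C k n) (b : Fin k → Bool) : ℝ :=
  ∑ u : C.Node, ∑ v : C.Node, E.linkBitMeters b u v

/-- Average bit-meters of the circuit for uniformly distributed input bits. -/
def avgBitMeters (E : Computation C k n) : ℝ :=
  (∑ b : Fin k → Bool, E.bitMeters b) / 2 ^ k

end Computation

end InfoFriction

end

/-! A binary symmetric channel with crossover `p ≤ 1/2` replaces each symbol, with probability `2p`,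
by a fair coin. A region `S` with at most `m²` output nodes therefore has all its outputs erased
with probability at least `(2p)^(m²)`. If this exceeds `8 Pe`, some noise pattern lets the decoder
recover more than 7/8 of the inputs from the outputs outside `S` alone. The input bits stored in `S`
must then leave it in messages, and a counting argument shows that at least a quarter as many bits
cross the cut on average (`numInputs_le_sum_cutBits_of_error`). Variable lengths could carry
information too; a Kraft inequality with base four accounts for this.

Now tile the lattice by `m × m` cells. For each of `m` diagonal shifts of the tiling, at least `k/4`
bits on average cross cell boundaries. A link of length `d` is cut by at most `√2 d / lam` of these
shifts, so summing over shifts gives bit-meters at least `k m lam / (4√2)` (`mul_le_avgBitMeters`).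
The largest admissible `m` is of order `√(log(1/(10 Pe)) / log(1/(2p)))`. -/

namespace InfoFriction

/-! ## The Gaussian tail -/

theorem gaussianQ_nonneg (x : ℝ) : 0 ≤ gaussianQ x :=
  MeasureTheory.setIntegral_nonneg measurableSet_Ioi fun _ _ => by positivity

theorem gaussianQ_zero : gaussianQ 0 = 1 / 2 := by
  have h := integral_gaussian_Ioi (1 / 2)
  have e : ∀ t : ℝ, -t ^ 2 / 2 = -(1 / 2) * t ^ 2 := fun t => by ring
  have h2 : Real.sqrt (2 * Real.pi) ≠ 0 := by positivity
  simp only [gaussianQ, e, MeasureTheory.integral_const_mul, h]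
  rw [show Real.pi / (1 / 2) = 2 * Real.pi by ring]
  field_simp

theorem gaussianQ_le_half {x : ℝ} (hx : 0 ≤ x) : gaussianQ x ≤ 1 / 2 := by
  rw [← gaussianQ_zero]
  refine MeasureTheory.setIntegral_mono_set ?_ ?_ ?_
  · have h := (integrable_exp_neg_mul_sq (b := 1 / 2) (by norm_num)).const_mul
      (1 / Real.sqrt (2 * Real.pi))
    have e : ∀ t : ℝ, -t ^ 2 / 2 = -(1 / 2) * t ^ 2 := fun t => by ring
    simp only [e]
    exact h.integrableOn
  · exact Filter.Eventually.of_forall fun _ => by simp only [Pi.zero_apply]; positivity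
  · exact (Set.Ioi_subset_Ioi hx).eventuallyLE

/-! ## Erasing part of the output of a binary symmetric channel -/

theorem prod_sum_bsc_off {n : ℕ} (p : ℝ) (J : Finset (Fin n)) :
    ∑ z : Fin n → Bool, ∏ j, (if j ∈ J then 1 else if z j = false then 1 - p else p) =
      (2 : ℝ) ^ J.card := by
  classical
  have h := Finset.prod_univ_sum (fun _ : Fin n => (Finset.univ : Finset Bool))
    (fun j a => if j ∈ J then (1 : ℝ) else if a = false then 1 - p else p)
  rw [Fintype.piFinset_univ] at h
  rw [← h]
  have : ∀ j, ∑ a : Bool, (if j ∈ J then (1 : ℝ) else if a = false then 1 - p else p) =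
      if j ∈ J then 2 else 1 := by
    intro j
    by_cases hj : j ∈ J <;> simp [hj]
  simp only [this]
  rw [Finset.prod_ite_mem]
  simp

/-- Since `p ≤ 1 - p`, every factor indexed by `J` is at least `p`, whichever symbol is received:
this is the fair-noise component of the channel. -/
theorem pow_mul_prod_le_bscProb {n : ℕ} {p : ℝ} (hp0 : 0 ≤ p) (hp : p ≤ 1 / 2)
    (J : Finset (Fin n)) (x y : Fin n → Bool) :
    p ^ J.card * ∏ j, (if j ∈ J then 1 else if y j = x j then 1 - p else p) ≤
      bscProb p x y := by
  classical
  have h : p ^ J.card = ∏ j, if j ∈ J then p else 1 := by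
    rw [Finset.prod_ite_mem]; simp
  rw [h, ← Finset.prod_mul_distrib]
  refine Finset.prod_le_prod (fun j _ => ?_) (fun j _ => ?_)
  · split_ifs <;> nlinarith
  · split_ifs <;> linarith

/-- With probability `(2p)^|J|` the symbols in `J` are replaced by fair noise; if, whatever the
noise, at least `N` messages are then decoded wrongly, the block error is large. -/
theorem pow_mul_le_blockErrorProb {k n : ℕ} {p : ℝ} (hp0 : 0 ≤ p) (hp : p ≤ 1 / 2)
    (enc : (Fin k → Bool) → (Fin n → Bool)) (dec : (Fin n → Bool) → (Fin k → Bool))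
    (J : Finset (Fin n)) (N : ℝ)
    (h : ∀ z : Fin n → Bool, N ≤ ((Finset.univ.filter fun b =>
      dec (fun j => xor (if j ∈ J then false else enc b j) (z j)) ≠ b).card : ℝ)) :
    (2 * p) ^ J.card * N / 2 ^ k ≤ blockErrorProb p enc dec := by
  classical
  unfold blockErrorProb
  gcongr ?_ / _
  set w : (Fin n → Bool) → ℝ :=
    fun z => ∏ j, (if j ∈ J then 1 else if z j = false then 1 - p else p) with hw
  have hw0 : ∀ z, 0 ≤ w z := fun z => Finset.prod_nonneg fun j _ => by
    split_ifs <;> linarith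
  have key : ∀ b : Fin k → Bool,
      p ^ J.card * ∑ z : Fin n → Bool,
        (if dec (fun j => xor (if j ∈ J then false else enc b j) (z j)) ≠ b then w z else 0) ≤
      ∑ y : Fin n → Bool, if dec y ≠ b then bscProb p (enc b) y else 0 := by
    intro b
    -- Change of variable from received word to noise. On `J` the codeword is zeroed, so there `z`
    -- is the received word itself and carries nothing about `b`.
    set σ : (Fin n → Bool) → (Fin n → Bool) :=
      fun z j => xor (if j ∈ J then false else enc b j) (z j) with hσ
    have hinv : Function.Involutive σ := fun z => by
      funext j; simp only [hσ]; rw [← Bool.xor_assoc]; simp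
    rw [← Equiv.sum_comp hinv.toPerm (fun y => if dec y ≠ b then bscProb p (enc b) y else 0),
      Finset.mul_sum]
    refine Finset.sum_le_sum fun z _ => ?_
    change p ^ J.card * (if dec (σ z) ≠ b then w z else 0) ≤
      if dec (σ z) ≠ b then bscProb p (enc b) (σ z) else 0
    by_cases hd : dec (σ z) = b
    · simp [hd]
    · rw [if_pos hd, if_pos hd]
      refine le_trans (le_of_eq ?_) (pow_mul_prod_le_bscProb hp0 hp J (enc b) (σ z))
      congr 1
      refine Finset.prod_congr rfl fun j _ => ?_
      by_cases hj : j ∈ J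
      · simp [hj]
      · simp only [hσ, hj, if_false]
        cases enc b j <;> cases z j <;> simp
  calc (2 * p) ^ J.card * N = p ^ J.card * ∑ z, w z * N := by
        rw [← Finset.sum_mul, hw, prod_sum_bsc_off, mul_pow]; ring
    _ ≤ p ^ J.card * ∑ z : Fin n → Bool, ∑ b : Fin k → Bool,
        (if dec (fun j => xor (if j ∈ J then false else enc b j) (z j)) ≠ b then w z else 0) := by
        gcongr with z
        rw [← Finset.sum_filter, Finset.sum_const, nsmul_eq_mul, mul_comm]
        exact mul_le_mul_of_nonneg_right (h z) (hw0 z)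
    _ = ∑ b : Fin k → Bool, p ^ J.card * ∑ z : Fin n → Bool,
        (if dec (fun j => xor (if j ∈ J then false else enc b j) (z j)) ≠ b then w z else 0) := by
        rw [Finset.sum_comm, Finset.mul_sum]
    _ ≤ _ := Finset.sum_le_sum fun b _ => key b

theorem blockErrorProb_nonneg {k n : ℕ} {p : ℝ} (hp0 : 0 ≤ p) (hp : p ≤ 1 / 2)
    (enc : (Fin k → Bool) → (Fin n → Bool)) (dec : (Fin n → Bool) → (Fin k → Bool)) :
    0 ≤ blockErrorProb p enc dec := by
  simpa using pow_mul_le_blockErrorProb hp0 hp enc dec ∅ 0 fun z => by positivity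

/-! ## A Kraft inequality with base four -/

theorem card_filter_length_le (A : Finset (List Bool)) (l : ℕ) :
    (A.filter fun w => w.length = l).card ≤ 2 ^ l := by
  classical
  have h : A.filter (fun w => w.length = l) ⊆
      (Finset.univ : Finset (List.Vector Bool l)).image fun v => v.toList := by
    intro w hw
    simp only [Finset.mem_filter] at hw
    exact Finset.mem_image.2 ⟨⟨w, hw.2⟩, Finset.mem_univ _, rfl⟩
  calc _ ≤ _ := Finset.card_le_card h
    _ ≤ _ := Finset.card_image_le
    _ = 2 ^ l := by rw [Finset.card_univ, card_vector, Fintype.card_bool]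

theorem sum_quarter_pow_length_filter_le (A : Finset (List Bool)) (l : ℕ) :
    ∑ w ∈ A with w.length = l, (1 / 4 : ℝ) ^ w.length ≤ (1 / 2) ^ l := by
  rw [Finset.sum_congr rfl (g := fun _ => (1 / 4 : ℝ) ^ l)
    fun w hw => by rw [(Finset.mem_filter.1 hw).2]]
  rw [Finset.sum_const, nsmul_eq_mul]
  calc _ ≤ (2 : ℝ) ^ l * (1 / 4) ^ l := by
        gcongr; exact_mod_cast card_filter_length_le A l
    _ = _ := by rw [← mul_pow]; norm_num

theorem sum_range_half_pow_succ_le (N : ℕ) : ∑ l ∈ Finset.range N, (1 / 2 : ℝ) ^ (l + 1) ≤ 1 := by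
  have : ∑ l ∈ Finset.range N, (1 / 2 : ℝ) ^ (l + 1) = 1 - (1 / 2) ^ N := by
    induction N with
    | zero => simp
    | succ N ih => rw [Finset.sum_range_succ, ih]; ring
  rw [this]
  linarith [show (0 : ℝ) ≤ (1 / 2) ^ N by positivity]

/-- The strings need not be prefix-free; base four pays for that, as the at most `2^l` strings of
length `l` contribute at most `2^(-l)`. With mixed lengths the empty string must be excluded for the
total over `l ≥ 1` to stay below one; with a single length there is only one term. -/
theorem sum_quarter_pow_length_le_one (A : Finset (List Bool))
    (hA : (∀ w ∈ A, ∀ w' ∈ A, w.length = w'.length) ∨ ∀ w ∈ A, 1 ≤ w.length) :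
    ∑ w ∈ A, (1 / 4 : ℝ) ^ w.length ≤ 1 := by
  rcases hA with hA | hA
  · rcases A.eq_empty_or_nonempty with rfl | ⟨w₀, hw₀⟩
    · simp
    · have h := sum_quarter_pow_length_filter_le A w₀.length
      rw [Finset.filter_true_of_mem fun w hw => hA w hw w₀ hw₀] at h
      exact h.trans (pow_le_one₀ (by norm_num) (by norm_num))
  · set N := A.sup List.length with hN
    have hmap : ∀ w ∈ A, w.length - 1 ∈ Finset.range N := fun w hw => by
      have h1 : w.length ≤ N := Finset.le_sup (f := List.length) hw
      have h2 := hA w hw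
      rw [Finset.mem_range]; omega
    rw [← Finset.sum_fiberwise_of_maps_to hmap]
    refine (Finset.sum_le_sum fun l _ => ?_).trans (sum_range_half_pow_succ_le N)
    refine le_trans (le_of_eq ?_) (sum_quarter_pow_length_filter_le A (l + 1))
    refine Finset.sum_congr (Finset.filter_congr fun w hw => ?_) fun _ _ => rfl
    have h2 := hA w hw
    omega

/-! ## Information flow across a cut -/

namespace Computation

variable {M : ImplementationModel} {C : Circuit M} {k n : ℕ}

/-- Induction along the message order: a node outside `S` knows only inputs outside `S`, messages
that crossed the cut, and earlier messages from outside `S`. -/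
theorem message_eq_of_cut_eq (E : Computation C k n) (S : Set C.Node) {b b' : Fin k → Bool}
    (hb : ∀ i, E.inputNode i ∉ S → b i = b' i)
    (hT : ∀ t, E.src t ∈ S → E.dst t ∉ S → E.message b t = E.message b' t) (t) :
    E.src t ∉ S → E.message b t = E.message b' t := by
  induction t using WellFoundedLT.induction with
  | ind t ih =>
    intro ht
    refine E.message_causal t b b' (fun i hi => hb i (hi ▸ ht)) fun s hs hd => ?_
    by_cases hS : E.src s ∈ S
    · exact hT s hS (hd ▸ ht)
    · exact ih s hs hS

theorem output_eq_of_cut_eq (E : Computation C k n) (S : Set C.Node) {b b' : Fin k → Bool}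
    (hb : ∀ i, E.inputNode i ∉ S → b i = b' i)
    (hT : ∀ t, E.src t ∈ S → E.dst t ∉ S → E.message b t = E.message b' t) {j : Fin n}
    (hj : E.outputNode j ∉ S) : E.output b j = E.output b' j := by
  refine E.output_causal j b b' (fun i hi => hb i (hi ▸ hj)) fun s hd => ?_
  by_cases hS : E.src s ∈ S
  · exact hT s hS (hd ▸ hj)
  · exact E.message_eq_of_cut_eq S hb hT s hS

open Classical in
/-- Number of bits sent from `S` to its complement. -/
noncomputable def cutBits (E : Computation C k n) (S : Set C.Node) (b : Fin k → Bool) : ℕ :=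
  ∑ t with E.src t ∈ S ∧ E.dst t ∉ S, (E.message b t).length

open Classical in
/-- Number of input bits stored in `S`. -/
noncomputable def numInputs (E : Computation C k n) (S : Set C.Node) : ℕ :=
  (Finset.univ.filter fun i => E.inputNode i ∈ S).card

/-- On `H` an input is determined by its bits outside `S` and the cut transcript. Enlarging the sum
to all such pairs makes it factor over messages; each factor is at most one by the Kraft bound,
which leaves the number of outside inputs. -/
theorem sum_quarter_pow_cutBits_le (E : Computation C k n)
    (hE : E.IsFixedLength ∨ E.IsFlexibleLength) (S : Set C.Node) (H : Finset (Fin k → Bool))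
    (hH : ∀ b ∈ H, ∀ b' ∈ H, (∀ i, E.inputNode i ∉ S → b i = b' i) →
      (∀ t, E.src t ∈ S → E.dst t ∉ S → E.message b t = E.message b' t) → b = b') :
    ∑ b ∈ H, (1 / 4 : ℝ) ^ E.cutBits S b ≤ 2 ^ k / 2 ^ E.numInputs S := by
  classical
  set I := {i : Fin k // E.inputNode i ∉ S}
  set τ := {t : Fin E.numMessages // E.src t ∈ S ∧ E.dst t ∉ S}
  set φ : (Fin k → Bool) → (I → Bool) × (τ → List Bool) :=
    fun b => (fun i => b i, fun t => E.message b t) with hφ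
  set A : τ → Finset (List Bool) := fun t => Finset.univ.image fun b => E.message b t with hA
  set f : (I → Bool) × (τ → List Bool) → ℝ := fun x => ∏ t, (1 / 4 : ℝ) ^ (x.2 t).length with hf
  have hf0 : ∀ x, 0 ≤ f x := fun x => Finset.prod_nonneg fun _ _ => by positivity
  have hinj : Set.InjOn φ H := by
    intro b hb b' hb' h
    simp only [hφ, Prod.mk.injEq] at h
    exact hH b hb b' hb' (fun i hi => congrFun h.1 ⟨i, hi⟩)
      fun t h1 h2 => congrFun h.2 ⟨t, h1, h2⟩
  have hcut : ∀ b, (1 / 4 : ℝ) ^ E.cutBits S b = f (φ b) := by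
    intro b
    simp only [hf, hφ, cutBits]
    rw [Finset.prod_pow_eq_pow_sum]
    congr 1
    exact Finset.sum_subtype (p := fun t => E.src t ∈ S ∧ E.dst t ∉ S) _ (by simp)
      fun t => (E.message b t).length
  have hA1 : ∀ t, ∑ w ∈ A t, (1 / 4 : ℝ) ^ w.length ≤ 1 := by
    intro t
    refine sum_quarter_pow_length_le_one _ (hE.imp (fun h => ?_) fun h => ?_)
    · simp only [hA, Finset.mem_image, Finset.mem_univ, true_and]
      rintro _ ⟨b, rfl⟩ _ ⟨b', rfl⟩
      exact h t b b'
    · simp only [hA, Finset.mem_image, Finset.mem_univ, true_and]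
      rintro _ ⟨b, rfl⟩
      exact h t b
  have hcard : Fintype.card I + E.numInputs S = k := by
    have h := Finset.card_filter_add_card_filter_not (s := (Finset.univ : Finset (Fin k)))
      (fun i => E.inputNode i ∈ S)
    rw [Finset.card_univ, Fintype.card_fin] at h
    rw [Fintype.card_subtype, numInputs, add_comm]
    exact h
  calc ∑ b ∈ H, (1 / 4 : ℝ) ^ E.cutBits S b = ∑ x ∈ H.image φ, f x := by
        rw [Finset.sum_image hinj]; exact Finset.sum_congr rfl fun b _ => hcut b
    _ ≤ ∑ x ∈ Finset.univ ×ˢ Fintype.piFinset A, f x := by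
        refine Finset.sum_le_sum_of_subset_of_nonneg ?_ fun x _ _ => hf0 x
        intro x hx
        obtain ⟨b, _, rfl⟩ := Finset.mem_image.1 hx
        simp [hφ, hA]
    _ = 2 ^ Fintype.card I * ∏ t, ∑ w ∈ A t, (1 / 4 : ℝ) ^ w.length := by
        rw [Finset.sum_product, Finset.prod_univ_sum]
        simp [hf]
    _ ≤ 2 ^ Fintype.card I * 1 := by
        gcongr
        exact Finset.prod_le_one (fun t _ => Finset.sum_nonneg fun _ _ => by positivity)
          fun t _ => hA1 t
    _ = 2 ^ k / 2 ^ E.numInputs S := by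
        rw [mul_one, eq_div_iff (by positivity), ← pow_add, hcard]

theorem numInputs_le_sum_cutBits (E : Computation C k n)
    (hE : E.IsFixedLength ∨ E.IsFlexibleLength) (S : Set C.Node) (H : Finset (Fin k → Bool))
    (hH : ∀ b ∈ H, ∀ b' ∈ H, (∀ i, E.inputNode i ∉ S → b i = b' i) →
      (∀ t, E.src t ∈ S → E.dst t ∉ S → E.message b t = E.message b' t) → b = b')
    (hcard : 7 / 8 * (2 : ℝ) ^ k ≤ H.card) :
    (E.numInputs S : ℝ) / 4 * 2 ^ k ≤ ∑ b, (E.cutBits S b : ℝ) := by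
  rcases Nat.eq_zero_or_pos (E.numInputs S) with h0 | hpos
  · rw [h0]; simp only [Nat.cast_zero, zero_div, zero_mul]; positivity
  set s : ℕ := E.numInputs S
  have hs1 : (1 : ℝ) ≤ s := by exact_mod_cast hpos
  have hsum := E.sum_quarter_pow_cutBits_le hE S H hH
  -- Convexity: the tangent to `4^(-B)` at `B = s/2` turns the exponential sum into a bound on the
  -- average of `B`.
  have htan : ∀ B : ℕ, (1 + s * Real.log 2 - 2 * Real.log 2 * B) / 2 ^ s ≤ (1 / 4 : ℝ) ^ B := by
    intro B
    rw [div_le_iff₀ (by positivity)]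
    have h := Real.add_one_le_exp (s * Real.log 2 - 2 * Real.log 2 * B)
    have e : Real.exp (s * Real.log 2 - 2 * Real.log 2 * B) = (1 / 4 : ℝ) ^ B * 2 ^ s := by
      rw [Real.exp_sub, Real.exp_nat_mul, Real.exp_log (by norm_num),
        show 2 * Real.log 2 * (B : ℝ) = B * (2 * Real.log 2) by ring, Real.exp_nat_mul,
        two_mul, Real.exp_add, Real.exp_log (by norm_num), div_pow]
      norm_num
      ring
    linarith
  have h1 : ∑ b ∈ H, (1 + s * Real.log 2 - 2 * Real.log 2 * E.cutBits S b) / 2 ^ s ≤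
      (2 : ℝ) ^ k / 2 ^ s := (Finset.sum_le_sum fun b _ => htan _).trans hsum
  rw [← Finset.sum_div, div_le_div_iff_of_pos_right (by positivity), Finset.sum_sub_distrib,
    Finset.sum_const, nsmul_eq_mul, ← Finset.mul_sum] at h1
  have h2 : ∑ b ∈ H, (E.cutBits S b : ℝ) ≤ ∑ b, (E.cutBits S b : ℝ) :=
    Finset.sum_le_sum_of_subset_of_nonneg (Finset.subset_univ _) fun _ _ _ => by positivity
  have hl1 := Real.log_two_gt_d9
  have hl2 := Real.log_two_lt_d9
  have hl0 : (0 : ℝ) < Real.log 2 := by linarith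
  have hK : (0 : ℝ) < 2 ^ k := by positivity
  have h3 : 7 / 8 * (2 : ℝ) ^ k * (1 + s * Real.log 2) ≤ H.card * (1 + s * Real.log 2) := by
    gcongr
  have h4 : 2 * Real.log 2 * ∑ b ∈ H, (E.cutBits S b : ℝ) ≤
      2 * Real.log 2 * ∑ b, (E.cutBits S b : ℝ) := by gcongr
  have h5 : (2 : ℝ) ^ k * (7 / 8 * (1 + s * Real.log 2) - 1) ≤
      2 * Real.log 2 * ∑ b, (E.cutBits S b : ℝ) := by linarith
  -- Equivalent to `3 s log 2 ≥ 1`, which holds for `s ≥ 1`; this is why `s = 0` was split off.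
  have h6 : 2 * Real.log 2 * (s / 4) ≤ 7 / 8 * (1 + s * Real.log 2) - 1 := by
    nlinarith [mul_le_mul_of_nonneg_right hs1 hl0.le]
  have h7 : 2 * Real.log 2 * (s / 4 * 2 ^ k) ≤ 2 * Real.log 2 * ∑ b, (E.cutBits S b : ℝ) := by
    nlinarith [mul_le_mul_of_nonneg_left h6 hK.le]
  exact le_of_mul_le_mul_left h7 (by positivity)

open Classical in
/-- If erasing the outputs in `S` is likelier than a block error, a constant fraction of the inputs
in `S` has to be communicated out of `S`. -/
theorem numInputs_le_sum_cutBits_of_error (E : Computation C k n)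
    (hE : E.IsFixedLength ∨ E.IsFlexibleLength) (S : Set C.Node) {p : ℝ} (hp0 : 0 ≤ p)
    (hp : p ≤ 1 / 2) (dec : (Fin n → Bool) → (Fin k → Bool))
    (herr : 8 * blockErrorProb p E.output dec <
      (2 * p) ^ (Finset.univ.filter fun j => E.outputNode j ∈ S).card) :
    (E.numInputs S : ℝ) / 4 * 2 ^ k ≤ ∑ b, (E.cutBits S b : ℝ) := by
  set J := Finset.univ.filter fun j => E.outputNode j ∈ S with hJ
  by_contra hlt
  refine absurd (pow_mul_le_blockErrorProb hp0 hp E.output dec J (2 ^ k / 8) fun z => ?_) ?_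
  · by_contra hz
    push Not at hz
    set g : (Fin k → Bool) → (Fin k → Bool) :=
      fun b => dec (fun j => xor (if j ∈ J then false else E.output b j) (z j)) with hg
    -- `H` is the set of inputs decoded correctly under the fixed noise `z`. The decoder sees only
    -- outputs outside `S`, so equal outside inputs and cut transcripts force equal decoded words.
    refine hlt (E.numInputs_le_sum_cutBits hE S (Finset.univ.filter fun b => g b = b) ?_ ?_)
    · intro b hb b' hb' hin hT
      rw [← (Finset.mem_filter.1 hb).2, ← (Finset.mem_filter.1 hb').2]
      simp only [hg]
      congr 1
      funext j
      by_cases hj : j ∈ J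
      · simp [hj]
      · simp only [hj, if_false]
        rw [E.output_eq_of_cut_eq S hin hT (j := j) (by simpa [hJ] using hj)]
    · have h := Finset.card_filter_add_card_filter_not
        (s := (Finset.univ : Finset (Fin k → Bool))) (fun b => g b = b)
      rw [Finset.card_univ, Fintype.card_fun, Fintype.card_bool, Fintype.card_fin] at h
      have h' : ((Finset.univ.filter fun b => g b = b).card : ℝ) +
          ((Finset.univ.filter fun b => ¬ g b = b).card : ℝ) = 2 ^ k := by exact_mod_cast h
      have hz' : ((Finset.univ.filter fun b => ¬ g b = b).card : ℝ) < 2 ^ k / 8 := hz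
      linarith
  · rw [not_le]
    have : (2 * p) ^ J.card * ((2 : ℝ) ^ k / 8) / 2 ^ k = (2 * p) ^ J.card / 8 := by
      field_simp
    rw [this]
    linarith

/-! ## Stencils of square cells -/

/-- Hermite's identity: moving `x` to `x + 1` drops the first term and appends one larger by exactly
one. -/
theorem _root_.Int.sum_range_add_ediv (m : ℕ) (hm : 0 < m) (x : ℤ) :
    ∑ r ∈ Finset.range m, (x + r) / (m : ℤ) = x := by
  have hm' : (m : ℤ) ≠ 0 := by exact_mod_cast hm.ne'
  have step : ∀ y : ℤ, ∑ r ∈ Finset.range m, (y + 1 + r) / (m : ℤ) =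
      ∑ r ∈ Finset.range m, (y + r) / (m : ℤ) + 1 := by
    intro y
    have h1 := Finset.sum_range_succ (fun r : ℕ => (y + r) / (m : ℤ)) m
    have h2 := Finset.sum_range_succ' (fun r : ℕ => (y + r) / (m : ℤ)) m
    rw [Int.add_ediv_of_dvd_right dvd_rfl, Int.ediv_self hm'] at h1
    have h3 : ∑ r ∈ Finset.range m, (y + 1 + r) / (m : ℤ) =
        ∑ r ∈ Finset.range m, (y + ((r + 1 : ℕ) : ℤ)) / (m : ℤ) :=
      Finset.sum_congr rfl fun r _ => by push_cast; ring_nf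
    rw [h3]
    simp only [Nat.cast_zero, add_zero] at h2
    linarith
  induction x using Int.induction_on with
  | zero =>
    refine Finset.sum_eq_zero fun r hr => ?_
    rw [zero_add]
    exact Int.ediv_eq_zero_of_lt (by positivity) (by exact_mod_cast Finset.mem_range.1 hr)
  | succ i ih => rw [step, ih]
  | pred i ih =>
    have := step (-(i : ℤ) - 1)
    rw [sub_add_cancel, ih] at this
    linarith

/-- For `x ≤ y`, the indicator of being separated is at most the difference of the quotients, and
these differences sum to `y - x` by Hermite's identity. -/
theorem _root_.Int.card_filter_add_ediv_ne_le (m : ℕ) (hm : 0 < m) (x y : ℤ) :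
    (((Finset.range m).filter fun r : ℕ => (x + r) / (m : ℤ) ≠ (y + r) / (m : ℤ)).card : ℤ) ≤
      |x - y| := by
  wlog hxy : x ≤ y generalizing x y
  · have := this y x (le_of_not_ge hxy)
    rw [abs_sub_comm]
    simpa only [ne_comm] using this
  rw [abs_sub_comm, abs_of_nonneg (sub_nonneg.2 hxy)]
  have hm' : (0 : ℤ) < m := by exact_mod_cast hm
  calc _ = ∑ r ∈ Finset.range m, if (x + r) / (m : ℤ) ≠ (y + r) / (m : ℤ) then (1 : ℤ) else 0 := by
        rw [Finset.sum_boole]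
    _ ≤ ∑ r ∈ Finset.range m, ((y + r) / (m : ℤ) - (x + r) / (m : ℤ)) := by
        refine Finset.sum_le_sum fun r _ => ?_
        have : (x + r) / (m : ℤ) ≤ (y + r) / (m : ℤ) := Int.ediv_le_ediv hm' (by linarith)
        split_ifs with h <;> omega
    _ = y - x := by
        rw [Finset.sum_sub_distrib, Int.sum_range_add_ediv m hm, Int.sum_range_add_ediv m hm]

theorem bitMeters_eq_sum (E : Computation C k n) (b : Fin k → Bool) :
    E.bitMeters b = ∑ t, ((E.message b t).length : ℝ) *
      dist (E.src t : EuclideanSpace ℝ (Fin 2)) (E.dst t : EuclideanSpace ℝ (Fin 2)) := by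
  classical
  unfold bitMeters linkBitMeters linkBits
  rw [← Fintype.sum_prod_type']
  have hmap : ∀ t ∈ (Finset.univ : Finset (Fin E.numMessages)),
      (E.src t, E.dst t) ∈ (Finset.univ : Finset (C.Node × C.Node)) := fun _ _ => Finset.mem_univ _
  rw [← Finset.sum_fiberwise_of_maps_to hmap]
  refine Finset.sum_congr rfl fun uv _ => ?_
  push_cast
  rw [Finset.sum_mul]
  refine Finset.sum_congr (by ext t; simp [Prod.ext_iff]) fun t ht => ?_
  obtain ⟨h1, h2⟩ : E.src t = uv.1 ∧ E.dst t = uv.2 := by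
    simpa [Prod.ext_iff] using ht
  rw [h1, h2]

theorem _root_.InfoFriction.Circuit.exists_lattice_coordinates (C : Circuit M) :
    ∃ X Y : C.Node → ℤ, ∀ u : C.Node, (u : EuclideanSpace ℝ (Fin 2)) =
      !₂[(X u : ℝ) * M.lam, (Y u : ℝ) * M.lam] := by
  have h : ∀ u : C.Node, ∃ s t : ℤ, (u : EuclideanSpace ℝ (Fin 2)) =
      !₂[(s : ℝ) * M.lam, (t : ℝ) * M.lam] := fun u => (C.nodes_subset u.2).1
  choose X Y hXY using h
  exact ⟨X, Y, hXY⟩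

theorem mul_abs_add_abs_le_dist (lam a b c d : ℝ) :
    lam * (|a - c| + |b - d|) ≤
      Real.sqrt 2 * dist (!₂[a * lam, b * lam] : EuclideanSpace ℝ (Fin 2)) !₂[c * lam, d * lam] := by
  rw [EuclideanSpace.dist_eq, Fin.sum_univ_two, ← Real.sqrt_mul (by norm_num)]
  refine Real.le_sqrt_of_sq_le ?_
  simp only [Real.dist_eq, Matrix.cons_val_zero, Matrix.cons_val_one, sq_abs]
  rw [← sub_mul, ← sub_mul, mul_pow, mul_pow, mul_pow, ← sq_abs (a - c), ← sq_abs (b - d)]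
  nlinarith [mul_nonneg (sq_nonneg lam) (sq_nonneg (|a - c| - |b - d|))]

/-- Bits crossing cell boundaries of a labelling of the nodes. -/
theorem sum_cutBits_cells (E : Computation C k n) {κ : Type*} [DecidableEq κ]
    (cell : C.Node → κ) (b : Fin k → Bool) :
    ∑ c ∈ Finset.univ.image cell, E.cutBits {u | cell u = c} b =
      ∑ t with cell (E.src t) ≠ cell (E.dst t), (E.message b t).length := by
  classical
  have hmap : ∀ t ∈ Finset.univ.filter (fun t => cell (E.src t) ≠ cell (E.dst t)),
      cell (E.src t) ∈ Finset.univ.image cell := fun t _ =>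
    Finset.mem_image_of_mem _ (Finset.mem_univ _)
  rw [← Finset.sum_fiberwise_of_maps_to hmap]
  refine Finset.sum_congr rfl fun c _ => ?_
  unfold cutBits
  refine Finset.sum_congr ?_ fun _ _ => rfl
  ext t
  simp only [Finset.mem_filter, Finset.mem_univ, true_and, Set.mem_ofPred_eq]
  constructor
  · rintro ⟨rfl, h⟩; exact ⟨fun h' => h h'.symm, rfl⟩
  · rintro ⟨h, rfl⟩; exact ⟨rfl, fun h' => h h'.symm⟩

theorem sum_numInputs_cells (E : Computation C k n) {κ : Type*} [DecidableEq κ]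
    (cell : C.Node → κ) :
    ∑ c ∈ Finset.univ.image cell, E.numInputs {u | cell u = c} = k := by
  classical
  have h := Finset.card_eq_sum_card_fiberwise (f := fun i => cell (E.inputNode i))
    (s := (Finset.univ : Finset (Fin k))) (t := Finset.univ.image cell)
    fun i _ => Finset.mem_coe.2 (Finset.mem_image_of_mem _ (Finset.mem_univ _))
  rw [Finset.card_univ, Fintype.card_fin] at h
  refine Eq.trans (Finset.sum_congr rfl fun c _ => ?_) h.symm
  unfold numInputs
  simp only [Set.mem_ofPred_eq]

/-- A stencil cell of `m × m` lattice points holds at most `m²` outputs. -/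
theorem card_outputs_cell_le (E : Computation C k n) {X Y : C.Node → ℤ}
    (hXY : ∀ u : C.Node, (u : EuclideanSpace ℝ (Fin 2)) = !₂[(X u : ℝ) * M.lam, (Y u : ℝ) * M.lam])
    {m : ℕ} (hm : 0 < m) (r : ℤ) (c : ℤ × ℤ) (J : Finset (Fin n))
    (hJ : ∀ j ∈ J, ((X (E.outputNode j) + r) / (m : ℤ), (Y (E.outputNode j) + r) / (m : ℤ)) = c) :
    J.card ≤ m ^ 2 := by
  have hm' : (0 : ℤ) < m := by exact_mod_cast hm
  have h := Finset.card_le_card_of_injOn (s := J)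
    (t := Finset.Ico (0 : ℤ) m ×ˢ Finset.Ico (0 : ℤ) m)
    (fun j => ((X (E.outputNode j) + r) % (m : ℤ), (Y (E.outputNode j) + r) % (m : ℤ))) ?_ ?_
  · simpa [Finset.card_product, sq] using h
  · intro j _
    simp [Int.emod_nonneg _ hm'.ne', Int.emod_lt_of_pos _ hm']
  · intro j hj j' hj' he
    have h1 := (hJ j hj).trans (hJ j' hj').symm
    simp only [Prod.mk.injEq] at h1 he
    have hx : X (E.outputNode j) = X (E.outputNode j') := by
      have e1 := Int.emod_add_mul_ediv (X (E.outputNode j) + r) m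
      have e2 := Int.emod_add_mul_ediv (X (E.outputNode j') + r) m
      rw [h1.1, he.1] at e1
      linarith
    have hy : Y (E.outputNode j) = Y (E.outputNode j') := by
      have e1 := Int.emod_add_mul_ediv (Y (E.outputNode j) + r) m
      have e2 := Int.emod_add_mul_ediv (Y (E.outputNode j') + r) m
      rw [h1.2, he.2] at e1
      linarith
    refine E.outputNode.injective (Subtype.ext ?_)
    rw [hXY, hXY (E.outputNode j'), hx, hy]

theorem avgBitMeters_nonneg (E : Computation C k n) : 0 ≤ E.avgBitMeters := by
  unfold avgBitMeters
  simp only [bitMeters_eq_sum]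
  positivity

/-- If erasing `m²` channel outputs is likelier than a block error, then the inputs travel a
distance of order `m` lattice spacings. -/
theorem mul_le_avgBitMeters (E : Computation C k n)
    (hE : E.IsFixedLength ∨ E.IsFlexibleLength) {p : ℝ} (hp0 : 0 ≤ p)
    (hp : p ≤ 1 / 2) (dec : (Fin n → Bool) → (Fin k → Bool)) {m : ℕ} (hm : 0 < m)
    (herr : 8 * blockErrorProb p E.output dec < (2 * p) ^ (m ^ 2)) :
    k * m * M.lam / (4 * Real.sqrt 2) ≤ E.avgBitMeters := by
  classical
  obtain ⟨X, Y, hXY⟩ := C.exists_lattice_coordinates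
  set cell : ℕ → C.Node → ℤ × ℤ :=
    fun r u => ((X u + r) / (m : ℤ), (Y u + r) / (m : ℤ)) with hcell
  have hcut : ∀ r : ℕ, (k : ℝ) / 4 * 2 ^ k ≤ ∑ b : Fin k → Bool, ∑ t,
      if cell r (E.src t) ≠ cell r (E.dst t) then ((E.message b t).length : ℝ) else 0 := by
    intro r
    calc (k : ℝ) / 4 * 2 ^ k
        = ∑ c ∈ Finset.univ.image (cell r),
            (E.numInputs {u | cell r u = c} : ℝ) / 4 * 2 ^ k := by
          rw [← Finset.sum_mul, ← Finset.sum_div, ← Nat.cast_sum, E.sum_numInputs_cells]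
      _ ≤ ∑ c ∈ Finset.univ.image (cell r), ∑ b, (E.cutBits {u | cell r u = c} b : ℝ) := by
          refine Finset.sum_le_sum fun c _ =>
            E.numInputs_le_sum_cutBits_of_error hE _ hp0 hp dec (herr.trans_le ?_)
          refine pow_le_pow_of_le_one (by positivity) (by linarith) ?_
          exact E.card_outputs_cell_le hXY hm r c _ fun j hj =>
            by simpa using hj
      _ = _ := by
          rw [Finset.sum_comm]
          refine Finset.sum_congr rfl fun b _ => ?_
          rw [← Nat.cast_sum, E.sum_cutBits_cells (cell r) b, ← Finset.sum_filter, Nat.cast_sum]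
  -- The same shift `r` acts on both coordinates, so a link is cut by at most `|Δx| + |Δy|` of the
  -- `m` shifts; comparing the `ℓ¹` and Euclidean norms gives the factor `√2`.
  have hcross : ∀ u v : C.Node,
      M.lam * ∑ r ∈ Finset.range m, (if cell r u ≠ cell r v then (1 : ℝ) else 0) ≤
        Real.sqrt 2 * dist (u : EuclideanSpace ℝ (Fin 2)) (v : EuclideanSpace ℝ (Fin 2)) := by
    intro u v
    rw [hXY u, hXY v]
    refine le_trans ?_ (mul_abs_add_abs_le_dist _ _ _ _ _)
    refine mul_le_mul_of_nonneg_left ?_ M.lam_pos.le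
    rw [Finset.sum_boole]
    have h1 := Int.card_filter_add_ediv_ne_le m hm (X u) (X v)
    have h2 := Int.card_filter_add_ediv_ne_le m hm (Y u) (Y v)
    have h3 : ((Finset.range m).filter fun r => cell r u ≠ cell r v).card ≤
        ((Finset.range m).filter fun r : ℕ => (X u + r) / (m : ℤ) ≠ (X v + r) / (m : ℤ)).card +
        ((Finset.range m).filter fun r : ℕ => (Y u + r) / (m : ℤ) ≠ (Y v + r) / (m : ℤ)).card := by
      refine le_trans (Finset.card_le_card ?_) (Finset.card_union_le _ _)
      intro r
      simp only [hcell, Finset.mem_filter, Finset.mem_union, ne_eq, Prod.mk.injEq]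
      tauto
    have h4 : (((Finset.range m).filter fun r => cell r u ≠ cell r v).card : ℤ) ≤
        |X u - X v| + |Y u - Y v| := by
      refine le_trans ?_ (add_le_add h1 h2)
      exact_mod_cast h3
    exact_mod_cast h4
  have hsum : M.lam * (m * ((k : ℝ) / 4 * 2 ^ k)) ≤ Real.sqrt 2 * ∑ b, E.bitMeters b := by
    calc M.lam * (m * ((k : ℝ) / 4 * 2 ^ k))
        = M.lam * ∑ r ∈ Finset.range m, (k : ℝ) / 4 * 2 ^ k := by simp
      _ ≤ M.lam * ∑ r ∈ Finset.range m, ∑ b : Fin k → Bool, ∑ t,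
          if cell r (E.src t) ≠ cell r (E.dst t) then ((E.message b t).length : ℝ) else 0 :=
          mul_le_mul_of_nonneg_left (Finset.sum_le_sum fun r _ => hcut r) M.lam_pos.le
      _ = ∑ b : Fin k → Bool, ∑ t, ((E.message b t).length : ℝ) *
          (M.lam * ∑ r ∈ Finset.range m,
            if cell r (E.src t) ≠ cell r (E.dst t) then (1 : ℝ) else 0) := by
          rw [Finset.sum_comm, Finset.mul_sum]
          refine Finset.sum_congr rfl fun b _ => ?_
          rw [Finset.sum_comm, Finset.mul_sum]
          refine Finset.sum_congr rfl fun t _ => ?_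
          rw [mul_left_comm, Finset.mul_sum (Finset.range m) _ ((E.message b t).length : ℝ)]
          simp only [mul_ite, mul_one, mul_zero]
      _ ≤ ∑ b : Fin k → Bool, ∑ t, ((E.message b t).length : ℝ) * (Real.sqrt 2 *
          dist (E.src t : EuclideanSpace ℝ (Fin 2)) (E.dst t : EuclideanSpace ℝ (Fin 2))) := by
          exact Finset.sum_le_sum fun b _ => Finset.sum_le_sum fun t _ =>
            mul_le_mul_of_nonneg_left (hcross _ _) (Nat.cast_nonneg _)
      _ = _ := by
          rw [Finset.mul_sum]
          refine Finset.sum_congr rfl fun b _ => ?_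
          rw [E.bitMeters_eq_sum, Finset.mul_sum]
          exact Finset.sum_congr rfl fun t _ => by ring
  unfold avgBitMeters
  rw [div_le_div_iff₀ (by positivity) (by positivity)]
  linarith

end Computation

end InfoFriction

/-! ### Choice of the cell size and the final constant -/

theorem theorem2 (M : InfoFriction.ImplementationModel) (Ch : InfoFriction.ChannelModel)
    (PT : ℝ) (hPT : 0 < PT) (k n : ℕ) (C : InfoFriction.Circuit M)
    (Enc : InfoFriction.Computation C k n)
    (hEnc : Enc.IsFixedLength ∨ Enc.IsFlexibleLength)
    (dec : (Fin n → Bool) → (Fin k → Bool)) (Pe pch : ℝ)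
    (hpch : pch = Ch.pch PT)
    (hPe : Pe = InfoFriction.blockErrorProb pch Enc.output dec)
    (hcond : Real.log (1 / (10 * Pe)) > 50 * Real.log (1 / (2 * pch))) :
    Enc.avgBitMeters ≥
      (k : ℝ) / (48 * Real.sqrt 2) *
        Real.sqrt (Real.log (1 / (10 * Pe)) / Real.log (1 / (2 * pch))) * M.lam := by
  have hp0 : 0 ≤ pch := hpch ▸ InfoFriction.gaussianQ_nonneg _
  have hp : pch ≤ 1 / 2 := hpch ▸ InfoFriction.gaussianQ_le_half (Real.sqrt_nonneg _)
  have hPe0 : 0 ≤ Pe := hPe ▸ InfoFriction.blockErrorProb_nonneg hp0 hp _ _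
  set L := Real.log (1 / (2 * pch)) with hL
  set A := Real.log (1 / (10 * Pe)) with hA
  have hL0 : 0 ≤ L := by
    rcases hp0.eq_or_lt with h | h
    · rw [hL, ← h]; simp
    · exact Real.log_nonneg (by rw [le_div_iff₀ (by positivity)]; linarith)
  -- `L = 0` means `pch = 1/2` or, by the conventions `1 / 0 = 0` and `log 0 = 0`, `pch = 0`. Then
  -- `A / L = 0` and the claimed bound is zero.
  rcases hL0.eq_or_lt with hL0 | hL0
  · rw [← hL0]
    simpa using Enc.avgBitMeters_nonneg
  have hp1 : 0 < pch := hp0.lt_of_ne fun h => by rw [hL, ← h] at hL0; simp at hL0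
  -- By the same conventions `Pe = 0` would give `A = 0`, contradicting `A > 50 L > 0`.
  have hPe1 : 0 < Pe := hPe0.lt_of_ne fun h => by
    have : A = 0 := by rw [hA, ← h]; simp
    linarith
  have hR : 50 < A / L := by rw [lt_div_iff₀ hL0]; linarith
  set s := Real.sqrt (A / L) with hs
  have hs1 : 1 ≤ s := Real.one_le_sqrt.2 (by linarith)
  -- The largest `m` with `m² L ≤ A`, that is `10 Pe ≤ (2 pch)^(m²)`; replacing 10 by 8 makes the
  -- inequality strict.
  set m := ⌊s⌋₊ with hm
  have hm1 : 1 ≤ m := Nat.one_le_floor_iff _ |>.2 hs1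
  have hms : (m : ℝ) ≤ s := Nat.floor_le (by positivity)
  have hsm : s < m + 1 := Nat.lt_floor_add_one s
  have hm1' : (1 : ℝ) ≤ m := by exact_mod_cast hm1
  have herr : 8 * InfoFriction.blockErrorProb pch Enc.output dec < (2 * pch) ^ (m ^ 2) := by
    rw [← hPe]
    have h1 : (m : ℝ) ^ 2 * L ≤ A := by
      rw [← le_div_iff₀ hL0, ← Real.sq_sqrt (show 0 ≤ A / L by linarith)]
      gcongr
    have h2 : 10 * Pe ≤ (2 * pch) ^ (m ^ 2) := by
      rw [← Real.log_le_log_iff (by positivity) (by positivity), Real.log_pow]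
      rw [hL, hA, one_div, one_div, Real.log_inv, Real.log_inv] at h1
      push_cast
      linarith
    linarith
  have hmain := Enc.mul_le_avgBitMeters hEnc hp0 hp dec hm1 herr
  refine le_trans ?_ hmain
  have h2 : (0 : ℝ) < Real.sqrt 2 := by positivity
  -- `s < m + 1 ≤ 2m` already holds; the factor 12 is what turns `4√2` into the stated `48√2`.
  have h3 : s ≤ 12 * m := by linarith
  calc (k : ℝ) / (48 * Real.sqrt 2) * s * M.lam
      ≤ (k : ℝ) / (48 * Real.sqrt 2) * (12 * m) * M.lam := by
        have := M.lam_pos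
        gcongr
    _ = k * m * M.lam / (4 * Real.sqrt 2) := by field_simp; ring
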